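/- Let $A$ be a finite set. All operations are of positive (finite) arity; a partial operation on $A$ is a function $f:\operatorname{dom} f\to A$ with $\operatorname{dom} f\subseteq A^n$, $n\ge 1$, and it is total if $\operatorname{dom} f=A^n$. For an $n$-ary $f$ and $m$-ary $g_1,\dots,g_n$, the composition $f(g_1,\dots,g_n)$ is the $m$-ary partial operation $x\mapsto f(g_1(x),\dots,g_n(x))$, defined at exactly those $x\in\bigcap_i\operatorname{dom} g_i$ with $(g_1(x),\dots,g_n(x))\in\operatorname{dom} f$. A partial clone is a set of partial operations that contains all projections and is closed under composition; it is strong if it contains every restriction of each of its members. A clone is a partial clone all of whose members are total. For a clone $D$ let $\mathrm{Int}_{\mathrm{Str}}(D)$ be the set of all strong partial clones $X$ on $A$ whose set of total members is $D$. For a relation $\rho\subseteq A^h$ let $\mathrm{Pol}\,\rho$ be the clone of all total operations $f$ preserving $\rho$ (applying $f$ coordinatewise to tuples of $\rho$ gives a tuple of $\rho$). For $a\in A$ let $c_a$ be the constant operation with value $a$ (a clone contains $c_a$ in one arity iff it does so in every arity). A relation $\rho\subseteq A^h$ is called $h$-universal if there are $m\ge 1$ and a surjection $\varphi=(\varphi_1,\dots,\varphi_m):A\to\{0,\dots,h-1\}^m$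 such that $\rho$ is the set of all $(x_1,\dots,x_h)\in A^h$ such that for each $i\in\{1,\dots,m\}$ there are $j\neq k$ with $\varphi_i(x_j)=\varphi_i(x_k)$. A relation $\rho\subseteq A^4$ is called prime affine if $|A|\ge 2$ and, for some prime $p$ and some abelian group structure on $A$ with $pa=0$ for all $a\in A$, $\rho=\{(x,y,z,t)\in A^4: x+y=z+t\}$. **Theorem.** Let $D$ be a clone on $A$ such that $D\subseteq\mathrm{Pol}\,\rho$ for some $h$-universal relation $\rho$ with $3\le h\le |A|-1$, or for some prime affine relation $\rho$ on $A$. If $c_a\notin D$ for some $a\in A$, then $\mathrm{Int}_{\mathrm{Str}}(D)$ has the cardinality of the continuum. -/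

import Mathlib

namespace PartialClones

/-- A partial operation of arity `n + 1` on `A`, for some `n : ℕ` (so all arities are positive):
a partial function from `A ^ (n + 1)` to `A`. -/
abbrev POp (A : Type*) := Σ n : ℕ, ((Fin (n + 1) → A) →. A)

variable {A : Type*}

/-- The projection of arity `n + 1` onto the coordinate `i`. -/
def proj (A : Type*) (n : ℕ) (i : Fin (n + 1)) : POp A := ⟨n, fun x => Part.some (x i)⟩

/-- The constant operation of arity `n + 1` with value `a`. -/
def const (n : ℕ) (a : A) : POp A := ⟨n, fun _ => Part.some a⟩

/-- The composition `f (g₁, …, gₙ)`: it is defined at `x` iff every `gᵢ` is defined at `x` and `f` is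
defined at `(g₁ x, …, gₙ x)`. -/
def comp {n m : ℕ} (f : (Fin (n + 1) → A) →. A) (g : Fin (n + 1) → ((Fin (m + 1) → A) →. A)) :
    (Fin (m + 1) → A) →. A :=
  fun x => Part.assert (∀ i, (g i x).Dom) fun hx => f fun i => (g i x).get (hx i)

/-- The set of all total operations (of positive arity) on `A`. -/
def totalOps (A : Type*) : Set (POp A) := {f | ∀ x, (f.2 x).Dom}

/-- A partial clone: contains all projections and is closed under composition. -/
structure IsPartialClone (X : Set (POp A)) : Prop where
  proj_mem : ∀ (n : ℕ) (i : Fin (n + 1)), proj A n i ∈ X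
  comp_mem : ∀ {n m : ℕ} (f : (Fin (n + 1) → A) →. A)
    (g : Fin (n + 1) → ((Fin (m + 1) → A) →. A)),
    (⟨n, f⟩ : POp A) ∈ X → (∀ i, (⟨m, g i⟩ : POp A) ∈ X) → (⟨m, comp f g⟩ : POp A) ∈ X

/-- A (total) clone: a partial clone all of whose members are total. -/
structure IsTotalClone (C : Set (POp A)) : Prop where
  isPartialClone : IsPartialClone C
  total : C ⊆ totalOps A

/-- A set of partial operations is strong if it contains every restriction of each of its members. -/
def IsStrong (X : Set (POp A)) : Prop :=
  ∀ (n : ℕ) (f g : (Fin (n + 1) → A) →. A), (⟨n, g⟩ : POp A) ∈ X →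
    (∀ x, ∀ y ∈ f x, y ∈ g x) → (⟨n, f⟩ : POp A) ∈ X

/-- The interval of all strong partial clones whose set of total members is `C`. -/
def intStr (C : Set (POp A)) : Set (Set (POp A)) :=
  {X | IsPartialClone X ∧ IsStrong X ∧ X ∩ totalOps A = C}

/-- `f` preserves the `h`-ary relation `ρ`: for every matrix with columns `M j ∈ ρ` all of whose rows
lie in the domain of `f`, the column `y` obtained by applying `f` to the rows belongs to `ρ`. -/
def Preserves {h : ℕ} (f : POp A) (ρ : Set (Fin h → A)) : Prop :=
  ∀ M : Fin (f.1 + 1) → Fin h → A, (∀ j, M j ∈ ρ) →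
    ∀ y : Fin h → A, (∀ i, y i ∈ f.2 fun j => M j i) → y ∈ ρ

/-- The set of all total operations preserving `ρ`. -/
def Pol {h : ℕ} (ρ : Set (Fin h → A)) : Set (POp A) := {f | Preserves f ρ} ∩ totalOps A

/-- The `h`-ary elementary relation on `{0, …, h - 1} ^ m`: all `h`-tuples which in each of the `m`
coordinates have two equal entries. -/
def elementaryRel (h m : ℕ) : Set (Fin h → (Fin m → Fin h)) :=
  {t | ∀ i : Fin m, ∃ j k : Fin h, j ≠ k ∧ t j i = t k i}

/-- `ρ` is `h`-universal: it is the inverse image, under a surjection, of an `h`-ary elementary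
relation. -/
def IsUniversalRel {h : ℕ} (ρ : Set (Fin h → A)) : Prop :=
  ∃ m : ℕ, 1 ≤ m ∧ ∃ φ : A → (Fin m → Fin h), Function.Surjective φ ∧
    ρ = {x | (fun j => φ (x j)) ∈ elementaryRel h m}

/-- `ρ` is prime affine: `ρ = {(x, y, z, t) | x + y = z + t}` for some structure of a nontrivial
elementary abelian `p`-group on `A`, with `p` prime. -/
def IsPrimeAffineRel (ρ : Set (Fin 4 → A)) : Prop :=
  Nontrivial A ∧ ∃ (p : ℕ) (_ : AddCommGroup A), p.Prime ∧ (∀ a : A, p • a = 0) ∧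
    ρ = {x | x 0 + x 1 = x 2 + x 3}

end PartialClones

/-! Continuum is an upper bound because there are only countably many partial operations. For the
lower bound, strong partial clones over `D` are built by adding to the restrictions of members of
`D` an ideal of partial operations with small domains: those from a fixed strong partial clone `Y` ⊇
`D` whose domain is carried by a tuple of operations of `D` into a prescribed set. If no such tuple
carries a full power of `A` into a prescribed set, no new total operation appears
(`union_domIdeal_mem_intStr`). The missing constant `a` supplies such sets, and operations `q k`
lying in the clone of `S` exactly when `k ∈ S` finish the proof.

Universal case: the prescribed set is `{a}`, and `Y` varies with `S`. Each coordinate under `φ` of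
an operation preserving `ρ` is either not surjective or a permutation of one coordinate of one
argument, by a Słupecki-type argument. Hence `D` preserves every lift of `colRel`, while the `l`-ary
operation described by `ValAt` violates the relation with `l` columns and preserves those with `k ≠
l` columns.

Affine case: `Y` contains everything, and the prescribed sets vary: points with few entries other
than `a`, in rapidly growing dimensions. Counting arguments for affine functions show that none of
these sets can be mapped into another. -/

namespace PartialClones

/-! ### Members of the interval obtained from domain ideals -/

section

variable {A : Type*}

/-- The total operation given by a function. -/
def ofFun {n : ℕ} (F : (Fin (n + 1) → A) → A) : POp A := ⟨n, fun x => Part.some (F x)⟩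

/-- All restrictions of the total operations that belong to `D`. -/
def restrictions (D : Set (POp A)) : Set (POp A) :=
  {f | ∃ F : (Fin (f.1 + 1) → A) → A, ofFun F ∈ D ∧ ∀ x, ∀ y ∈ f.2 x, y = F x}

/-- All partial operations preserving the relation `R`. -/
def pPol {ι : Type*} (R : Set (ι → A)) : Set (POp A) :=
  {f | ∀ M : Fin (f.1 + 1) → ι → A, (∀ j, M j ∈ R) →
    ∀ y : ι → A, (∀ i, y i ∈ f.2 fun j => M j i) → y ∈ R}

/-- The members of `Y` whose domain is mapped by operations of `D` into some member of `𝓔`. -/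
def domIdeal (D Y : Set (POp A)) (𝓔 : Set (Σ n : ℕ, Set (Fin (n + 1) → A))) : Set (POp A) :=
  {f | f ∈ Y ∧ ∃ E ∈ 𝓔, ∃ t : Fin (E.1 + 1) → (Fin (f.1 + 1) → A) → A,
    (∀ i, ofFun (t i) ∈ D) ∧ ∀ x, (f.2 x).Dom → (fun i => t i x) ∈ E.2}

theorem mem_comp {n m : ℕ} {f : (Fin (n + 1) → A) →. A}
    {g : Fin (n + 1) → ((Fin (m + 1) → A) →. A)} {x : Fin (m + 1) → A} {y : A} :
    y ∈ comp f g x ↔ ∃ z : Fin (n + 1) → A, (∀ i, z i ∈ g i x) ∧ y ∈ f z := by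
  constructor
  · rintro ⟨⟨h, h'⟩, rfl⟩
    exact ⟨fun i => (g i x).get (h i), fun i => Part.get_mem _, Part.get_mem _⟩
  · rintro ⟨z, hz, hy⟩
    have hd : ∀ i, (g i x).Dom := fun i => Part.dom_iff_mem.2 ⟨_, hz i⟩
    have hz' : (fun i => (g i x).get (hd i)) = z :=
      funext fun i => Part.get_eq_of_mem (hz i) _
    obtain ⟨h1, h2⟩ := hy
    refine ⟨⟨hd, ?_⟩, ?_⟩
    · change (f fun i => (g i x).get (hd i)).Dom
      rw [hz']; exact h1
    · change (f fun i => (g i x).get (hd i)).get _ = y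
      simp only [hz', h2]

theorem dom_comp {n m : ℕ} {f : (Fin (n + 1) → A) →. A}
    {g : Fin (n + 1) → ((Fin (m + 1) → A) →. A)} {x : Fin (m + 1) → A} (h : (comp f g x).Dom) :
    ∃ z : Fin (n + 1) → A, (∀ i, z i ∈ g i x) ∧ (f z).Dom := by
  obtain ⟨y, hy⟩ := Part.dom_iff_mem.1 h
  obtain ⟨z, hz, hy⟩ := mem_comp.1 hy
  exact ⟨z, hz, Part.dom_iff_mem.2 ⟨y, hy⟩⟩

theorem IsTotalClone.ofFun_proj {D : Set (POp A)} (hD : IsTotalClone D) {n : ℕ} (i : Fin (n + 1)) :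
    ofFun (fun x => x i) ∈ D :=
  hD.isPartialClone.proj_mem n i

theorem IsTotalClone.ofFun_comp {D : Set (POp A)} (hD : IsTotalClone D) {n m : ℕ}
    {F : (Fin (n + 1) → A) → A} {G : Fin (n + 1) → (Fin (m + 1) → A) → A} (hF : ofFun F ∈ D)
    (hG : ∀ i, ofFun (G i) ∈ D) : ofFun (fun x => F fun i => G i x) ∈ D := by
  have h := hD.isPartialClone.comp_mem (fun x => Part.some (F x)) (fun i x => Part.some (G i x)) hF hG
  suffices he : (comp (fun x => Part.some (F x)) fun i x => Part.some (G i x)) =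
      fun x => Part.some (F fun i => G i x) by
    rw [he] at h
    exact h
  funext x
  ext y
  refine mem_comp.trans ?_
  simp only [Part.mem_some_iff]
  constructor
  · rintro ⟨z, hz, rfl⟩
    rw [funext hz]
  · rintro rfl
    exact ⟨_, fun _ => rfl, rfl⟩

theorem restrictions_subset {D Y : Set (POp A)} (hY : IsStrong Y) (h : D ⊆ Y) :
    restrictions D ⊆ Y := by
  rintro ⟨n, f⟩ ⟨F, hF, hf⟩
  exact hY n f _ (h hF) fun x y hy => Part.mem_some_iff.2 (hf x y hy)

/-- Closure under composition: if all inner operations are restrictions from `D`, substituting their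
extensions into `t` handles an outer ideal member; if some inner operation is in the ideal, its `t`
still works because composition only shrinks the domain. A total ideal member would contradict `h𝓔`.
-/
theorem union_domIdeal_mem_intStr {D Y : Set (POp A)} (hD : IsTotalClone D)
    (hY : IsPartialClone Y) (hYs : IsStrong Y) (hDY : D ⊆ Y)
    {𝓔 : Set (Σ n : ℕ, Set (Fin (n + 1) → A))}
    (h𝓔 : ∀ E ∈ 𝓔, ∀ (m : ℕ) (t : Fin (E.1 + 1) → (Fin (m + 1) → A) → A),
      (∀ i, ofFun (t i) ∈ D) → ∃ x, (fun i => t i x) ∉ E.2) :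
    restrictions D ∪ domIdeal D Y 𝓔 ∈ intStr D := by
  have hsub : restrictions D ∪ domIdeal D Y 𝓔 ⊆ Y :=
    Set.union_subset (restrictions_subset hYs hDY) fun f hf => hf.1
  refine ⟨⟨fun n i => ?_, fun {n m} f g hf hg => ?_⟩, ?_, ?_⟩
  · exact Or.inl ⟨fun x => x i, hD.ofFun_proj i, fun x y hy => Part.mem_some_iff.1 hy⟩
  · have hmem : (⟨m, comp f g⟩ : POp A) ∈ Y := hY.comp_mem f g (hsub hf) fun i => hsub (hg i)
    by_cases hall : ∀ i, (⟨m, g i⟩ : POp A) ∈ restrictions D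
    · choose G hG hgG using hall
      rcases hf with ⟨F, hF, hfF⟩ | ⟨-, E, hE, t, ht, htE⟩
      · refine Or.inl ⟨_, hD.ofFun_comp hF hG, fun x y hy => ?_⟩
        obtain ⟨z, hz, hy⟩ := mem_comp.1 hy
        rw [hfF z y hy, show z = fun i => G i x from funext fun i => hgG i x _ (hz i)]
      · refine Or.inr ⟨hmem, E, hE, fun i x => t i fun l => G l x,
          fun i => hD.ofFun_comp (ht i) hG, fun x hx => ?_⟩
        obtain ⟨z, hz, hd⟩ := dom_comp hx
        obtain rfl : z = fun i => G i x := funext fun i => hgG i x _ (hz i)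
        exact htE _ hd
    · push Not at hall
      obtain ⟨i, hi⟩ := hall
      obtain ⟨-, E, hE, t, ht, htE⟩ := (hg i).resolve_left hi
      refine Or.inr ⟨hmem, E, hE, t, ht, fun x hx => ?_⟩
      obtain ⟨z, hz, -⟩ := dom_comp hx
      exact htE x (Part.dom_iff_mem.2 ⟨_, hz i⟩)
  · rintro n f g (⟨G, hG, hgG⟩ | ⟨hgY, E, hE, t, ht, htE⟩) hfg
    · exact Or.inl ⟨G, hG, fun x y hy => hgG x y (hfg x y hy)⟩
    · refine Or.inr ⟨hYs n f g hgY hfg, E, hE, t, ht, fun x hx => htE x ?_⟩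
      exact Part.dom_iff_mem.2 ⟨_, hfg x _ (Part.get_mem hx)⟩
  · ext f
    constructor
    · rintro ⟨⟨F, hF, hfF⟩ | ⟨-, E, hE, t, ht, htE⟩, htot⟩
      · have : f = ofFun F := by
          obtain ⟨n, f⟩ := f
          simp only [ofFun]
          congr
          funext x
          exact Part.eq_some_iff.2 (hfF x _ (Part.get_mem (htot x)) ▸ Part.get_mem (htot x))
        exact this ▸ hF
      · obtain ⟨x, hx⟩ := h𝓔 E hE f.1 t ht
        exact absurd (htE x (htot x)) hx
    · intro hf
      exact ⟨Or.inl ⟨fun x => (f.2 x).get (hD.total hf x), by simpa [ofFun] using hf,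
        fun x y hy => (Part.get_eq_of_mem hy _).symm⟩, hD.total hf⟩

theorem isPartialClone_pPol {ι : Type*} (R : Set (ι → A)) : IsPartialClone (pPol R) where
  proj_mem n i M hM y hy := by
    rw [show y = M i from funext fun l => Part.mem_some_iff.1 (hy l)]
    exact hM i
  comp_mem f g hf hg M hM y hy := by
    choose z hz hyz using fun i => mem_comp.1 (hy i)
    exact hf (fun j i => z i j) (fun j => hg j M hM _ fun i => hz i j) y hyz

theorem isStrong_pPol {ι : Type*} (R : Set (ι → A)) : IsStrong (pPol R) :=
  fun _ _ _ hg hfg M hM y hy => hg M hM y fun i => hfg _ _ (hy i)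

theorem isPartialClone_iInter {ι : Sort*} {X : ι → Set (POp A)} (h : ∀ i, IsPartialClone (X i)) :
    IsPartialClone (⋂ i, X i) where
  proj_mem n i := Set.mem_iInter.2 fun k => (h k).proj_mem n i
  comp_mem f g hf hg := Set.mem_iInter.2 fun k =>
    (h k).comp_mem f g (Set.mem_iInter.1 hf k) fun i => Set.mem_iInter.1 (hg i) k

theorem isStrong_iInter {ι : Sort*} {X : ι → Set (POp A)} (h : ∀ i, IsStrong (X i)) :
    IsStrong (⋂ i, X i) :=
  fun n f g hg hfg => Set.mem_iInter.2 fun k => h k n f g (Set.mem_iInter.1 hg k) hfg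

theorem mk_intStr_le [Finite A] (D : Set (POp A)) : Cardinal.mk (intStr D) ≤ Cardinal.continuum := by
  have : Finite (Part A) := by
    classical exact Finite.of_equiv _ (Part.equivOption (α := A)).symm
  have (n : ℕ) : Finite ((Fin (n + 1) → A) →. A) :=
    inferInstanceAs (Finite ((Fin (n + 1) → A) → Part A))
  have : Countable (POp A) := inferInstance
  refine (Cardinal.mk_set_le _).trans ?_
  rw [Cardinal.mk_set, ← Cardinal.two_power_aleph0]
  exact Cardinal.power_le_power_left two_ne_zero (Cardinal.mk_le_aleph0)

/-- A family of members of the interval indexed by sets of natural numbers, and separated by a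
sequence of operations, shows that the interval has the cardinality of the continuum. -/
theorem mk_intStr_eq_continuum [Finite A] {D : Set (POp A)} (X : Set ℕ → Set (POp A))
    (hX : ∀ S, X S ∈ intStr D) (q : ℕ → POp A) (hq : ∀ S k, q k ∈ X S ↔ k ∈ S) :
    Cardinal.mk (intStr D) = Cardinal.continuum := by
  refine (mk_intStr_le D).antisymm ?_
  have hinj : Function.Injective fun S : ULift (Set ℕ) => (⟨X S.down, hX S.down⟩ : intStr D) := by
    rintro ⟨S⟩ ⟨T⟩ h
    have h : X S = X T := congrArg Subtype.val h
    congr 1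
    ext k
    rw [← hq S k, h, hq T k]
  simpa using Cardinal.mk_le_of_injective hinj

theorem IsTotalClone.ofFun_const_notMem {D : Set (POp A)} (hD : IsTotalClone D) {n : ℕ} {a : A}
    (ha : const n a ∉ D) (m : ℕ) : ofFun (fun _ : Fin (m + 1) → A => a) ∉ D :=
  fun h => ha (hD.ofFun_comp h fun _ => hD.ofFun_proj (n := n) 0)

end

/-! ### A Słupecki-type lemma -/

section

variable {A : Type*}

/-- A function of several variables that is not constant takes different values at two points that
differ in one coordinate only. -/
theorem exists_line_ne {Z K L : Type*} [Finite Z] {G : (Z → K) → L} {x y : Z → K}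
    (hxy : G y ≠ G x) : ∃ (z : Z) (p q : Z → K), (∀ w, w ≠ z → p w = q w) ∧ G p ≠ G q := by
  classical
  by_contra! hcon
  have := Fintype.ofFinite Z
  have : ∀ s : Finset Z, G (s.piecewise y x) = G x := by
    intro s
    induction s using Finset.induction_on with
    | empty => simp
    | insert z s hz ih =>
      rw [← ih]
      refine hcon z _ _ fun w hw => ?_
      simp [Finset.piecewise, hw]
  exact hxy (by simpa using this Finset.univ)

/-- A weak form of Słupecki's lemma: a function of several variables with at least three values
which never takes three different values at three points that have a coincidence in every
coordinate depends on one variable only. -/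
theorem eq_comp_eval_of_coincidence {Z K L : Type*} (G : (Z → K) → L)
    (hG : ∀ p q r : Z → K, (∀ z, p z = q z ∨ q z = r z ∨ p z = r z) →
      G p = G q ∨ G q = G r ∨ G p = G r)
    [Finite Z] [Nonempty L] (h3 : ∀ c d : L, ∃ x, G x ≠ c ∧ G x ≠ d) : ∃ (z : Z) (π : K → L), ∀ x, G x = π (x z) := by
  classical
  -- The points `p`, `q`, `r` have a coincidence in every coordinate: `p` and `q` agree off `z`, and
  -- `r` meets one of them at `z`.
  have key : ∀ (z : Z) (p q r : Z → K), (∀ w, w ≠ z → p w = q w) → (r z = p z ∨ r z = q z) →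
      G p ≠ G q → G r = G p ∨ G r = G q := by
    intro z p q r hpq hr hne
    have := hG p q r fun w => by
      by_cases hw : w = z
      · subst hw
        rcases hr with h | h
        · exact Or.inr (Or.inr h.symm)
        · exact Or.inr (Or.inl h.symm)
      · exact Or.inl (hpq w hw)
    grind
  obtain ⟨x, -⟩ := h3 (Classical.arbitrary L) (Classical.arbitrary L)
  obtain ⟨y, hy, -⟩ := h3 (G x) (G x)
  obtain ⟨z, p, q, hpq, hne⟩ := exists_line_ne hy
  clear x y hy
  obtain ⟨r, hrp, hrq⟩ := h3 (G p) (G q)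
  have upd (x : Z → K) (c : K) (w : Z) (hw : w ≠ z) : x w = Function.update x z c w := by
    simp [hw]
  have updz (x : Z → K) (c : K) : Function.update x z c z = c := by simp
  have h1 := key z r (Function.update r z (p z))
  have h2 := key z r (Function.update r z (q z))
  -- Moving `r` along coordinate `z` to `p z` or `q z` changes the value of `G`, so `key` applies to
  -- these lines too. Intersecting the resulting pairs of values shows that `G` is constant on each
  -- of the three hyperplanes through `p`, `q`, `r`.
  have h3 : G (Function.update r z (p z)) = G p := by
    grind [key z p q (Function.update r z (p z)), h1 p]
  have h4 : G (Function.update r z (q z)) = G q := by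
    grind [key z p q (Function.update r z (q z)), h2 q]
  have hp (x : Z → K) (hx : x z = p z) : G x = G p := by
    grind [key z p q x, h1 x]
  have hq (x : Z → K) (hx : x z = q z) : G x = G q := by
    grind [key z p q x, h2 x]
  have hr (x : Z → K) (hx : x z = r z) : G x = G r := by
    grind [h1 x, h2 x]
  refine ⟨z, fun c => G (Function.update p z c), fun x => ?_⟩
  -- `G x` differs from at least two of `G p`, `G q`, `G r`; the two corresponding lines through `x`
  -- leave `G x` as the only possible value at `Function.update p z (x z)`.
  have e1 := key z x (Function.update x z (p z)) (Function.update p z (x z)) (upd x _)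
  have e2 := key z x (Function.update x z (q z)) (Function.update p z (x z)) (upd x _)
  have e3 := key z x (Function.update x z (r z)) (Function.update p z (x z)) (upd x _)
  have f1 := hp _ (updz x (p z))
  have f2 := hq _ (updz x (q z))
  have f3 := hr _ (updz x (r z))
  have f4 := updz p (x z)
  rw [f1] at e1
  rw [f2] at e2
  rw [f3] at e3
  have g1 := e1 (Or.inl f4)
  have g2 := e2 (Or.inl f4)
  have g3 := e3 (Or.inl f4)
  by_cases k1 : G x = G p <;> by_cases k2 : G x = G q <;> grind

end

/-! ### Universal relations -/

section

variable {A K : Type*}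

/-- The points at which the relations below are indexed: the elements of `K` other than `z`,
and `k` further points. -/
abbrev ColIndex (K : Type*) (z : K) (k : ℕ) := {c : K // c ≠ z} ⊕ Fin k

open Classical in
/-- The `j`-th column: the identity on `K`, and the indicator of `j` on the further points. -/
def col (z u : K) (k : ℕ) (j : Fin k) : ColIndex K z k → K :=
  Sum.elim Subtype.val fun i => if i = j then u else z

/-- All tuples that are not surjective, or arise from a column by permuting the values. -/
def colRel (z u : K) (k : ℕ) : Set (ColIndex K z k → K) :=
  {x | ¬ Function.Surjective x ∨
    ∃ (j : Fin k) (π : K → K), Function.Injective π ∧ ∀ p, x p = π (col z u k j p)}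

open Classical in
/-- The graph of the partial operation that is `c` at the constant tuples `(c, …, c)` with `c ≠ z`,
and `z` at the tuples having one entry `u` and all others `z`. -/
def ValAt (z u : K) {l : ℕ} (r : Fin l → K) (c : K) : Prop :=
  (c ≠ z ∧ ∀ s, r s = c) ∨ (c = z ∧ ∃ i, ∀ s, r s = if i = s then u else z)

theorem ValAt.unique {z u : K} (hzu : u ≠ z) {l : ℕ} (hl : 2 ≤ l) {r : Fin l → K} {c d : K}
    (hc : ValAt z u r c) (hd : ValAt z u r d) : c = d := by
  have key : ∀ c, c ≠ z → (∀ s, r s = c) → ∀ i, (∀ s, r s = if i = s then u else z) → False := by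
    intro c hc h i hi
    have : Nontrivial (Fin l) := Fin.nontrivial_iff_two_le.2 hl
    obtain ⟨s, hs⟩ := exists_ne i
    exact hc (by rw [← h s, hi s, if_neg hs.symm])
  rcases hc with ⟨hc, h⟩ | ⟨rfl, i, hi⟩ <;> rcases hd with ⟨hd, h'⟩ | ⟨rfl, i', hi'⟩
  · rw [← h ⟨0, by omega⟩, h']
  · exact (key c hc h i' hi').elim
  · exact (key d hd h' i hi).elim
  · rfl

theorem eq_of_col_ne {z u : K} {k : ℕ} {j : Fin k} {p : ColIndex K z k} {c : K}
    (h : col z u k j p = c) (hc : c ≠ z) : p = Sum.inl ⟨c, hc⟩ ∨ p = Sum.inr j := by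
  rcases p with p | i
  · exact Or.inl (by simp [← h, col])
  · right
    by_contra hne
    apply hc
    rw [← h]
    simp only [col, Sum.elim_inr, ite_eq_right_iff]
    rintro rfl
    exact (hne rfl).elim

/-- A counterexample forces each `t s` to be column `j s` up to a permutation fixing `z` and `u`,
and then `j` to be a bijection from `Fin l` to `Fin k`. -/
theorem valAt_mem_colRel {z u : K} (hzu : u ≠ z) {k l : ℕ} (hl : 4 ≤ l) (hkl : k ≠ l)
    {t : Fin l → ColIndex K z k → K} (ht : ∀ s, t s ∈ colRel z u k) {y : ColIndex K z k → K}
    (hy : ∀ p, ValAt z u (fun s => t s p) (y p)) : y ∈ colRel z u k := by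
  by_contra hcon
  have hsurj : Function.Surjective y := by
    by_contra h
    exact hcon (Or.inl h)
  have hval : ∀ p, y p ≠ z → ∀ s, t s p = y p := fun p hp =>
    ((hy p).resolve_right fun h => hp h.1).2
  -- If the row with its `u` in place `s` never occurred, `y` would equal `t s`.
  have hw : ∀ s, ∃ p, y p = z ∧ ∀ s', t s' p = if s = s' then u else z := by
    intro s
    by_contra! h
    refine hcon ?_
    convert ht s using 1
    funext p
    rcases hy p with ⟨-, hp⟩ | ⟨hp, i, hi⟩
    · exact (hp s).symm
    · have hi : ∀ s, t s p = if i = s then u else z := hi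
      rw [hi s, hp]
      by_cases his : i = s
      · subst his
        obtain ⟨s', hs'⟩ := h p hp
        exact (hs' (hi s')).elim
      · rw [if_neg his]
  choose w hwy hwt using hw
  have hwinj : Function.Injective w := by
    intro s s' h
    by_contra hne
    have := hwt s s'
    rw [h, hwt s' s', if_pos rfl, if_neg hne] at this
    exact hzu this
  have hnt : Nontrivial (Fin l) := Fin.nontrivial_iff_two_le.2 (by omega)
  have htsurj : ∀ s, Function.Surjective (t s) := by
    intro s c
    by_cases hc : c = z
    · obtain ⟨s', hs'⟩ := exists_ne s
      exact ⟨w s', by rw [hwt, if_neg hs', hc]⟩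
    · obtain ⟨p, rfl⟩ := hsurj c
      exact ⟨p, hval p hc s⟩
  choose j π hπ htπ using fun s => (ht s).resolve_left (not_not.2 (htsurj s))
  -- As `l ≥ 4`, `t s` takes the value `z` at three distinct points `w s'`; in a column only `z` can
  -- occur three times.
  have hπz : ∀ s, π s z = z := by
    intro s
    obtain ⟨a, b, c, ha, hb, hc, hab, hac, hbc⟩ : ∃ a b c : Fin l, a ≠ s ∧ b ≠ s ∧ c ≠ s ∧
        a ≠ b ∧ a ≠ c ∧ b ≠ c := by
      have hcard : 2 < (Finset.univ.erase s).card := by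
        rw [Finset.card_erase_of_mem (Finset.mem_univ _), Finset.card_univ, Fintype.card_fin]
        omega
      obtain ⟨a, ha, b, hb, c, hc, h⟩ := Finset.two_lt_card.1 hcard
      exact ⟨a, b, c, Finset.ne_of_mem_erase ha, Finset.ne_of_mem_erase hb,
        Finset.ne_of_mem_erase hc, h⟩
    have h : ∀ s', s' ≠ s → π s (col z u k (j s) (w s')) = z := fun s' hs' => by
      rw [← htπ, hwt, if_neg hs']
    by_contra hne
    have hz : col z u k (j s) (w a) ≠ z := fun h' => hne (by
      have := h a ha
      rwa [h'] at this)
    have e1 := eq_of_col_ne rfl hz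
    have e2 := eq_of_col_ne (hπ s ((h b hb).trans (h a ha).symm)) hz
    have e3 := eq_of_col_ne (hπ s ((h c hc).trans (h a ha).symm)) hz
    have n1 := hwinj.ne hab
    have n2 := hwinj.ne hac
    have n3 := hwinj.ne hbc
    rcases e1 with e1 | e1 <;> rcases e2 with e2 | e2 <;> rcases e3 with e3 | e3 <;>
      first
      | exact n1 (e1.trans e2.symm)
      | exact n2 (e1.trans e3.symm)
      | exact n3 (e2.trans e3.symm)
  have hcolj : ∀ s, col z u k (j s) (Sum.inr (j s)) = u := fun s => by simp [col]
  -- `t s` takes the value `u` at `w s` and at a point where `y` is `u`; the only value other than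
  -- `z` that a column repeats is `u`.
  have hπu : ∀ s, π s u = u := by
    intro s
    obtain ⟨p, hp⟩ := hsurj u
    have h1 : π s (col z u k (j s) p) = u := by rw [← htπ, hval p (hp ▸ hzu), hp]
    have h2 : π s (col z u k (j s) (w s)) = u := by rw [← htπ, hwt, if_pos rfl]
    have hpw : p ≠ w s := fun h => hzu (by rw [← hp, h, hwy])
    have hz : col z u k (j s) p ≠ z := fun h => hzu (by rw [← h1, h, hπz])
    rcases eq_of_col_ne rfl hz with e1 | e1
    · rcases eq_of_col_ne (hπ s (h2.trans h1.symm)) hz with e2 | e2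
      · exact (hpw (e1.trans e2.symm)).elim
      · rw [← hcolj s, ← e2, h2, e2, hcolj]
    · rw [← hcolj s, ← e1, h1, e1, hcolj]
  have htu : ∀ s, t s (Sum.inl ⟨u, hzu⟩) = u := fun s => by
    rw [htπ]
    exact hπu s
  have hyu : y (Sum.inl ⟨u, hzu⟩) = u := by
    refine ValAt.unique hzu (by omega) (hy _) (Or.inl ⟨hzu, htu⟩)
  have hti : ∀ s i, t s (Sum.inr i) = if i = j s then u else z := by
    intro s i
    rw [htπ]
    simp only [col, Sum.elim_inr]
    split_ifs
    · exact hπu s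
    · exact hπz s
  have hex : ∀ i, ∃ s, ∀ s', i = j s' ↔ s = s' := by
    intro i
    rcases hy (Sum.inr i) with ⟨hne, hi⟩ | ⟨-, s, hs⟩
    · exfalso
      have hall : ∀ s, i = j s := by
        intro s
        by_contra h
        have : t s (Sum.inr i) = y (Sum.inr i) := hi s
        rw [hti, if_neg h] at this
        exact hne this.symm
      let s : Fin l := ⟨0, by omega⟩
      have h1 : π s (col z u k (j s) (w s)) = u := by rw [← htπ, hwt, if_pos rfl]
      rcases eq_of_col_ne (hπ s (h1.trans (hπu s).symm)) hzu with h | h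
      · exact hzu (by rw [← hyu, ← h, hwy])
      · rw [← hall s] at h
        exact hne (by rw [← h, hwy])
    · refine ⟨s, fun s' => ?_⟩
      have : t s' (Sum.inr i) = if s = s' then u else z := hs s'
      rw [hti] at this
      split_ifs at this with h1 h2 h2
      · exact iff_of_true h1 h2
      · exact (hzu this).elim
      · exact (hzu this.symm).elim
      · exact iff_of_false h1 h2
  have hbij : Function.Bijective j := by
    constructor
    · intro s s' h
      obtain ⟨r, hr⟩ := hex (j s)
      rw [← (hr s).1 rfl, ← (hr s').1 h]
    · intro i
      obtain ⟨r, hr⟩ := hex i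
      exact ⟨r, ((hr r).2 rfl).symm⟩
  have := Fintype.card_of_bijective hbij
  simp only [Fintype.card_fin] at this
  exact hkl this.symm

/-- The identity on `K`, extended by `z` on the further points, does not belong to `colRel`. -/
theorem valAt_notMem_colRel {z u : K} (hzu : u ≠ z) {k : ℕ} (hk : 0 < k)
    {y : ColIndex K z k → K} (hy1 : ∀ c, y (Sum.inl c) = c) (hy2 : ∀ i, y (Sum.inr i) = z) :
    y ∉ colRel z u k := by
  rintro (h | ⟨j, π, -, hπ⟩)
  · refine h fun c => ?_
    by_cases hc : c = z
    · exact ⟨Sum.inr ⟨0, hk⟩, (hy2 _).trans hc.symm⟩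
    · exact ⟨Sum.inl ⟨c, hc⟩, hy1 _⟩
  · have h1 := hπ (Sum.inl ⟨u, hzu⟩)
    have h2 := hπ (Sum.inr j)
    rw [hy1] at h1
    rw [hy2] at h2
    simp only [col, Sum.elim_inl, Sum.elim_inr, if_true] at h1 h2
    exact hzu (h1.trans h2.symm)

/-- The relation on `A` whose images under all coordinates of `φ` lie in `R`. -/
def liftRel {ι I : Type*} (φ : A → I → K) (R : Set (ι → K)) : Set (ι → A) :=
  {x | ∀ i, (fun p => φ (x p) i) ∈ R}

/-- Operations preserving a universal relation are, coordinatewise, not surjective or essentially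
unary. -/
theorem essentially_unary_of_mem_Pol {h m : ℕ} (h3 : 3 ≤ h) {φ : A → Fin m → Fin h}
    (hφ : Function.Surjective φ) {n : ℕ} {F : (Fin (n + 1) → A) → A}
    (hF : ofFun F ∈ Pol {x : Fin h → A | (fun j => φ (x j)) ∈ elementaryRel h m}) (i : Fin m)
    (hs : Function.Surjective fun x => φ (F x) i) :
    ∃ (s : Fin (n + 1)) (l : Fin m) (π : Fin h → Fin h), Function.Bijective π ∧
      ∀ x, φ (F x) i = π (φ (x s) l) := by
  have hcoin : ∀ x y w : Fin (n + 1) → A,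
      (∀ s l, φ (x s) l = φ (y s) l ∨ φ (y s) l = φ (w s) l ∨ φ (x s) l = φ (w s) l) →
      φ (F x) i = φ (F y) i ∨ φ (F y) i = φ (F w) i ∨ φ (F x) i = φ (F w) i := by
    intro x y w hxyw
    by_contra! hne
    obtain ⟨n1, n2, n3⟩ := hne
    choose g hg using hs
    -- A transversal of the `h` values through `x`, `y`, `w`. Their coincidences put its rows into
    -- `ρ`, but its image is injective in coordinate `i`.
    let R : Fin h → Fin (n + 1) → A := fun c => if c = φ (F x) i then x else
      if c = φ (F y) i then y else if c = φ (F w) i then w else g c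
    have hR : ∀ c, φ (F (R c)) i = c := by
      intro c
      simp only [R]
      split_ifs with h1 h2 h4
      · exact h1.symm
      · exact h2.symm
      · exact h4.symm
      · exact hg c
    have Rx : R (φ (F x) i) = x := by simp [R]
    have Ry : R (φ (F y) i) = y := by simp [R, n1.symm]
    have Rw : R (φ (F w) i) = w := by simp [R, n2.symm, n3.symm]
    obtain ⟨c, d, hcd, he⟩ := hF.1 (fun s c => R c s) (fun s l => by
      rcases hxyw s l with e | e | e
      · exact ⟨_, _, n1, by simp only [Rx, Ry, e]⟩
      · exact ⟨_, _, n2, by simp only [Rw, Ry, e]⟩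
      · exact ⟨_, _, n3, by simp only [Rx, Rw, e]⟩) (fun c => F (R c))
      (fun c => Part.mem_some _) i
    simp only [hR] at he
    exact hcd he
  have hthird : ∀ c d : Fin h, ∃ x, φ (F x) i ≠ c ∧ φ (F x) i ≠ d := by
    intro c d
    obtain ⟨e, he⟩ : ∃ e, e ∉ ({c, d} : Finset (Fin h)) := by
      by_contra! hall
      have h1 := Finset.card_le_two (a := c) (b := d)
      rw [Finset.eq_univ_iff_forall.2 hall, Finset.card_univ, Fintype.card_fin] at h1
      omega
    obtain ⟨x, rfl⟩ := hs e
    exact ⟨x, by simpa using he⟩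
  -- Points with the same image under `φ` coincide everywhere, so comparison with a point of a third
  -- value forces equality.
  have hfactor : ∀ x y : Fin (n + 1) → A, (∀ s, φ (x s) = φ (y s)) → φ (F x) i = φ (F y) i := by
    intro x y hxy
    obtain ⟨w, h1, h2⟩ := hthird (φ (F x) i) (φ (F y) i)
    have := hcoin x y w fun s l => Or.inl (by rw [hxy])
    rcases this with e | e | e
    · exact e
    · exact (h2 e.symm).elim
    · exact (h1 e.symm).elim
  choose σ hσ using hφ
  have hne : Nonempty (Fin h) := ⟨⟨0, by omega⟩⟩
  let G : (Fin (n + 1) × Fin m → Fin h) → Fin h := fun v => φ (F fun s => σ fun l => v (s, l)) i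
  have hG : ∀ x, φ (F x) i = G fun q => φ (x q.1) q.2 := fun x =>
    hfactor _ _ fun s => by simp only [hσ]
  obtain ⟨⟨s, l⟩, π, hπ⟩ := eq_comp_eval_of_coincidence G
    (fun p q r hpqr => hcoin _ _ _ fun s l => by simpa only [hσ] using hpqr (s, l))
    (fun c d => by
      obtain ⟨x, hx⟩ := hthird c d
      exact ⟨fun q => φ (x q.1) q.2, by rw [← hG]; exact hx⟩)
  have hFπ : ∀ x, φ (F x) i = π (φ (x s) l) := fun x => (hG x).trans (hπ fun q => φ (x q.1) q.2)
  refine ⟨s, l, π, Finite.surjective_iff_bijective.1 fun c => ?_, hFπ⟩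
  obtain ⟨x, hx⟩ := hs c
  exact ⟨_, (hFπ x).symm.trans hx⟩

theorem Pol_subset_pPol_liftRel {h m : ℕ} (h3 : 3 ≤ h) {φ : A → Fin m → Fin h}
    (hφ : Function.Surjective φ) (z u : Fin h) (k : ℕ) :
    Pol {x : Fin h → A | (fun j => φ (x j)) ∈ elementaryRel h m} ⊆
      pPol (liftRel φ (colRel z u k)) := by
  rintro ⟨n, f⟩ hf M hM y hy i
  let F : (Fin (n + 1) → A) → A := fun x => (f x).get (hf.2 x)
  have hfF : (⟨n, f⟩ : POp A) = ofFun F := by simp [ofFun, F]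
  have hyF : ∀ p, y p = F fun s => M s p := fun p => (Part.get_eq_of_mem (hy p) _).symm
  rw [hfF] at hf
  by_cases hs : Function.Surjective fun x => φ (F x) i
  · obtain ⟨s, l, π, hπ, hFπ⟩ := essentially_unary_of_mem_Pol h3 hφ hf i hs
    have hyπ : (fun p => φ (y p) i) = fun p => π (φ (M s p) l) :=
      funext fun p => by rw [hyF, hFπ]
    rw [hyπ]
    rcases hM s l with hns | ⟨j, π', hπ', he⟩
    · exact Or.inl fun h => hns (h.of_comp_left (f := π) hπ.1)
    · exact Or.inr ⟨j, π ∘ π', hπ.1.comp hπ', fun p => congrArg π (he p)⟩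
  · refine Or.inl fun h => hs fun c => ?_
    obtain ⟨p, hp⟩ := h c
    exact ⟨_, by rw [← hp]; exact congrArg (φ · i) (hyF p).symm⟩

/-- The lift of `ValAt` to `A`, restricted to tuples with last entry `a`. -/
noncomputable def liftOp {I : Type*} (z u : K) (φ : A → I → K) (i₀ : I) (σ : K → A) (a : A) (l : ℕ) : POp A :=
  ⟨l, fun x => ⟨x (Fin.last l) = a ∧ ∃ c, ValAt z u (fun s : Fin l => φ (x s.castSucc) i₀) c,
    fun h => σ h.2.choose⟩⟩

theorem mk_intStr_of_universal [Finite A] {D : Set (POp A)} (hD : IsTotalClone D) {h : ℕ}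
    (h3 : 3 ≤ h) {ρ : Set (Fin h → A)} (hρ : IsUniversalRel ρ) (hDρ : D ⊆ Pol ρ) {n : ℕ} {a : A}
    (ha : const n a ∉ D) : Cardinal.mk (intStr D) = Cardinal.continuum := by
  obtain ⟨m, hm, φ, hφ, rfl⟩ := hρ
  let z : Fin h := ⟨0, by omega⟩
  let u : Fin h := ⟨1, by omega⟩
  have hzu : u ≠ z := by simp [z, u]
  let i₀ : Fin m := ⟨0, hm⟩
  choose σ' hσ' using id hφ
  let σ : Fin h → A := fun c => σ' fun _ => c
  have hσ : ∀ c i, φ (σ c) i = c := fun c i => by simp only [σ, hσ']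
  -- The shift by 4 provides the bound on `l` needed in `valAt_mem_colRel`.
  let Y : Set ℕ → Set (POp A) := fun S => ⋂ k : ↥Sᶜ, pPol (liftRel φ (colRel z u (k + 4)))
  refine mk_intStr_eq_continuum (fun S => restrictions D ∪ domIdeal D (Y S) {⟨0, {fun _ => a}⟩})
    (fun S => union_domIdeal_mem_intStr hD (isPartialClone_iInter fun _ => isPartialClone_pPol _)
      (isStrong_iInter fun _ => isStrong_pPol _)
      (Set.subset_iInter fun k => hDρ.trans (Pol_subset_pPol_liftRel h3 hφ z u _)) ?_)
    (fun k => liftOp z u φ i₀ σ a (k + 4)) fun S k => ⟨fun hq => ?_, fun hk => ?_⟩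
  · rintro E rfl N t ht
    by_contra! hall
    refine hD.ofFun_const_notMem ha N ?_
    convert ht 0 using 3 with x
    exact (congrFun (hall x) 0).symm
  · by_contra hk
    have hqY : liftOp z u φ i₀ σ a (k + 4) ∈ Y S :=
      Set.union_subset (restrictions_subset (isStrong_iInter fun _ => isStrong_pPol _)
        (Set.subset_iInter fun k => hDρ.trans (Pol_subset_pPol_liftRel h3 hφ z u _)))
        (fun f hf => hf.1) hq
    have hpres := Set.mem_iInter.1 hqY ⟨k, hk⟩
    let y : ColIndex (Fin h) z (k + 4) → Fin h := Sum.elim Subtype.val fun _ => z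
    have hval : ∀ p, ValAt z u (fun s : Fin (k + 4) => col z u (k + 4) s p) (y p) := by
      rintro (c | i)
      · exact Or.inl ⟨c.2, fun s => rfl⟩
      · exact Or.inr ⟨rfl, i, fun s => rfl⟩
    -- The extra last argument, constantly `a`, lies in the relation because a one-valued tuple is
    -- not surjective.
    have := hpres (Fin.lastCases (fun _ => a) fun s p => σ (col z u (k + 4) s p)) (fun s => by
      refine Fin.lastCases ?_ (fun s => ?_) s
      · intro i
        refine Or.inl fun hsurj => ?_
        obtain ⟨p, hp⟩ := hsurj z
        obtain ⟨p', hp'⟩ := hsurj u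
        simp only [Fin.lastCases_last] at hp hp'
        exact hzu (hp'.symm.trans hp)
      · intro i
        simp only [Fin.lastCases_castSucc, hσ]
        exact Or.inr ⟨s, id, Function.injective_id, fun _ => rfl⟩) (fun p => σ (y p)) (fun p => by
      have hd : ∃ c, ValAt z u (fun s : Fin (k + 4) => φ (Fin.lastCases
          (motive := fun _ => ColIndex (Fin h) z (k + 4) → A) (fun _ => a)
          (fun s p => σ (col z u (k + 4) s p)) s.castSucc p) i₀) c :=
        ⟨y p, by simpa only [Fin.lastCases_castSucc, hσ] using hval p⟩
      refine ⟨⟨congrFun (Fin.lastCases_last (motive := fun _ => ColIndex (Fin h) z (k + 4) → A)) p, hd⟩, congrArg σ ?_⟩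
      refine ValAt.unique hzu (by omega) hd.choose_spec ?_
      simpa only [Fin.lastCases_castSucc, hσ] using hval p) i₀
    simp only [hσ] at this
    exact valAt_notMem_colRel hzu (by omega) (fun _ => rfl) (fun _ => rfl) this
  · refine Or.inr ⟨Set.mem_iInter.2 fun ⟨k', hk'⟩ => ?_, _, rfl,
      fun _ x => x (Fin.last _), fun _ => hD.ofFun_proj _, fun x hx => funext fun _ => hx.1⟩
    intro M hM y hy i
    have hkk : k' + 4 ≠ k + 4 := fun h => hk' (by rw [show k' = k by omega]; exact hk)
    choose hd hyd using hy
    have hyi : (fun p => φ (y p) i) = fun p => (hd p).2.choose := funext fun p => by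
      rw [← hyd p]
      exact hσ _ _
    rw [hyi]
    exact valAt_mem_colRel hzu (by omega) hkk (fun s => hM s.castSucc i₀)
      fun p => (hd p).2.choose_spec

end

/-! ### Affine relations -/

section

variable {A : Type*}

open Classical in
/-- If each of `N` functions takes a value other than `a` on `S`, and at most `r` of them do so at
each point of `S`, then `N ≤ r * |S|`. -/
theorem le_mul_card_of_weight_le {X : Type*} {N r : ℕ} {a : A} {t : Fin N → X → A} {S : Finset X}
    (ht : ∀ i, ∃ x ∈ S, t i x ≠ a)
    (hS : ∀ x ∈ S, (Finset.univ.filter fun i => t i x ≠ a).card ≤ r) : N ≤ r * S.card := by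
  have hsub : (Finset.univ : Finset (Fin N)) ⊆
      S.biUnion fun x => Finset.univ.filter fun i => t i x ≠ a := by
    intro i _
    obtain ⟨x, hx, hi⟩ := ht i
    exact Finset.mem_biUnion.2 ⟨x, hx, by simpa using hi⟩
  have h1 := (Finset.card_le_card hsub).trans (Finset.card_biUnion_le_card_mul S _ r hS)
  rw [Finset.card_univ, Fintype.card_fin] at h1
  rwa [mul_comm]

variable [AddCommGroup A]

/-- The functions `F` for which the difference `F (x + v) - F x` depends on `v` only. -/
def IsAffineFun {Z : Type*} (F : (Z → A) → A) : Prop :=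
  ∀ x y v, F (x + v) + F y = F x + F (y + v)

theorem isAffineFun_of_mem_Pol {n : ℕ} {F : (Fin (n + 1) → A) → A}
    (hF : ofFun F ∈ Pol {x : Fin 4 → A | x 0 + x 1 = x 2 + x 3}) : IsAffineFun F := by
  intro x y v
  have := hF.1 (fun j => ![x j + v j, y j, x j, y j + v j]) (fun j => by
    simp only [Set.mem_ofPred_eq, Matrix.cons_val]
    abel) ![F (x + v), F y, F x, F (y + v)] (fun i => by
      fin_cases i <;> exact Part.mem_some _)
  simpa using this

/-- A change along one line persists everywhere, since `F (x + v) - F x` does not depend on `x`. -/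
theorem IsAffineFun.exists_shift {Z : Type*} [Finite Z] {F : (Z → A) → A} (hF : IsAffineFun F)
    {x y : Z → A} (hxy : F y ≠ F x) :
    ∃ (l : Z) (v : Z → A), (∀ w, w ≠ l → v w = 0) ∧ ∀ x, F (x + v) ≠ F x := by
  obtain ⟨l, p, q, hpq, hne⟩ := exists_line_ne hxy
  refine ⟨l, q - p, fun w hw => by simp [hpq w hw], fun x hx => hne ?_⟩
  have := hF x p (q - p)
  rw [hx, add_sub_cancel] at this
  exact add_left_cancel this

open Classical in
theorem IsAffineFun.exists_weight_le_one {Z : Type*} [Fintype Z] {F : (Z → A) → A}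
    (hF : IsAffineFun F) {a : A} {x : Z → A} (hx : F x ≠ a) :
    ∃ y : Z → A, (Finset.univ.filter fun l => y l ≠ a).card ≤ 1 ∧ F y ≠ a := by
  by_contra! hcon
  have h0 : F (fun _ => a) = a := hcon _ (by simp)
  obtain ⟨l, v, hv, hne⟩ := hF.exists_shift (x := fun _ => a) (y := x) (by rwa [h0])
  refine hne (fun _ => a) ?_
  rw [h0]
  refine hcon _ ((Finset.card_le_card (t := {l}) fun w hw => ?_).trans (Finset.card_singleton l).le)
  by_contra hwl
  rw [Finset.mem_singleton] at hwl
  simp [hv w hwl] at hw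

open Classical in
/-- If `N` affine functions different from the constant `a` map points with at most `2 r + 1`
entries other than `a` to points with at most `r` entries other than `a`, then `N ≤ 3 r`. -/
theorem le_of_affine_of_weight_le [Finite A] {Z : Type*} [Fintype Z] {N r : ℕ} {a : A}
    {t : Fin N → (Z → A) → A} (htaff : ∀ i, IsAffineFun (t i)) (ht : ∀ i, ∃ x, t i x ≠ a)
    (hr : ∀ x : Z → A, (Finset.univ.filter fun l => x l ≠ a).card ≤ 2 * r + 1 →
      (Finset.univ.filter fun i => t i x ≠ a).card ≤ r) : N ≤ 3 * r := by
  have := Fintype.ofFinite A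
  by_contra! hN
  have h0 := hr (fun _ => a) (by simp)
  have hsum := Finset.card_filter_add_card_filter_not (s := (Finset.univ : Finset (Fin N)))
    (fun i => t i (fun _ => a) ≠ a)
  rw [Finset.card_univ, Fintype.card_fin] at hsum
  obtain ⟨I, hI, hIcard⟩ := Finset.exists_subset_card_eq
    (s := Finset.univ.filter fun i => ¬ t i (fun _ => a) ≠ a) (n := 2 * r + 1) (by omega)
  -- Outside `I` the choice is arbitrary; it only requires `Z` to be nonempty. For empty `Z` all `N`
  -- functions would differ from `a` at the single point.
  have hshift : ∀ i : Fin N, ∃ (l : Z) (v : Z → A), i ∈ I →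
      (∀ w, w ≠ l → v w = 0) ∧ ∀ x, t i (x + v) ≠ t i x := by
    intro i
    obtain ⟨x, hx⟩ := ht i
    by_cases hi : i ∈ I
    · have h0 := (Finset.mem_filter.1 (hI hi)).2
      rw [not_not] at h0
      obtain ⟨l, v, h⟩ := (htaff i).exists_shift (x := fun _ => a) (y := x) (by rwa [h0])
      exact ⟨l, v, fun _ => h⟩
    · have hZ : Nonempty Z := by
        by_contra hZ
        have hZ' : IsEmpty Z := not_nonempty_iff.1 hZ
        have hle : Finset.univ.filter (fun i => t i (fun _ => a) ≠ a) = Finset.univ := by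
          refine Finset.filter_true_of_mem fun i _ => ?_
          obtain ⟨x, hx⟩ := ht i
          rwa [Subsingleton.elim (fun _ => a) x]
        rw [hle, Finset.card_univ, Fintype.card_fin] at h0
        omega
      exact ⟨hZ.some, 0, fun h => (hi h).elim⟩
  choose l v hlv using hshift
  -- At most `2 * r + 1` coordinates are free in `B`, so `hr` applies to all its points.
  let B : Finset (Z → A) := Finset.univ.filter fun x => ∀ w, w ∉ I.image l → x w = a
  have hBne : B.Nonempty := ⟨fun _ => a, by simp [B]⟩
  have hB : ∀ x ∈ B, (I.filter fun i => t i x ≠ a).card ≤ r := by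
    intro x hx
    refine (Finset.card_le_card ?_).trans (hr x ?_)
    · exact Finset.filter_subset_filter _ (Finset.subset_univ _)
    · refine (Finset.card_le_card (t := I.image l) fun w hw => ?_).trans
        (Finset.card_image_le.trans hIcard.le)
      by_contra hwI
      exact (Finset.mem_filter.1 hw).2 ((Finset.mem_filter.1 hx).2 w hwI)
  -- Translation by `v i` preserves `B` and injects the points where `t i` is `a` into those where
  -- it is not. Counting pairs then gives `(2 * r + 1) * |B| ≤ 2 * r * |B|`, which is absurd.
  have hhalf : ∀ i ∈ I, B.card ≤ 2 * (B.filter fun x => t i x ≠ a).card := by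
    intro i hi
    obtain ⟨hv, hne⟩ := hlv i hi
    have h1 := Finset.card_filter_add_card_filter_not (s := B) (fun x => t i x ≠ a)
    have h2 : (B.filter fun x => ¬ t i x ≠ a).card ≤ (B.filter fun x => t i x ≠ a).card := by
      refine Finset.card_le_card_of_injOn (· + v i) (fun x hx => ?_)
        (add_left_injective (v i)).injOn
      have hx := Finset.mem_filter.1 hx
      have hxB := (Finset.mem_filter.1 hx.1).2
      refine Finset.mem_filter.2 ⟨Finset.mem_filter.2 ⟨Finset.mem_univ _, fun w hw => ?_⟩, ?_⟩
      · have hwl : w ≠ l i := fun h => hw (h ▸ Finset.mem_image_of_mem l hi)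
        simp [hv w hwl, hxB w hw]
      · have := hne x
        rwa [not_not.1 hx.2] at this
    omega
  have hdouble := Finset.sum_card_bipartiteAbove_eq_sum_card_bipartiteBelow (s := I) (t := B)
    (fun i x => t i x ≠ a)
  have h1 : I.card * B.card ≤ 2 * ∑ i ∈ I, (B.filter fun x => t i x ≠ a).card := by
    rw [Finset.mul_sum, ← smul_eq_mul, ← Finset.sum_const]
    exact Finset.sum_le_sum hhalf
  have h2 : ∑ x ∈ B, (I.filter fun i => t i x ≠ a).card ≤ B.card * r := by
    rw [← smul_eq_mul, ← Finset.sum_const]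
    exact Finset.sum_le_sum hB
  simp only [Finset.bipartiteAbove, Finset.bipartiteBelow] at hdouble
  rw [hdouble, hIcard] at h1
  have h3 : 0 < B.card := hBne.card_pos
  nlinarith

/-- A fast growing sequence, depending on the parameter `c`. -/
def arityBound (c : ℕ) : ℕ → ℕ
  | 0 => c + 3
  | k + 1 => arityBound c k + 3 ^ (k + 1) * (c ^ (arityBound c k + 1) + c + 3)

theorem mul_le_arityBound (c k : ℕ) : 3 ^ k * (c + 3) ≤ arityBound c k := by
  cases k with
  | zero => simp [arityBound]
  | succ k =>
    rw [arityBound]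
    refine le_add_left (Nat.mul_le_mul_left _ ?_)
    omega

theorem arityBound_mono (c : ℕ) : Monotone (arityBound c) :=
  monotone_nat_of_le_succ fun k => by rw [arityBound]; exact Nat.le_add_right _ _

theorem mul_pow_le_arityBound {c : ℕ} (hc : 0 < c) {j k : ℕ} (hjk : j < k) :
    3 ^ k * c ^ (arityBound c j + 1) ≤ arityBound c k := by
  obtain ⟨k, rfl⟩ : ∃ k', k = k' + 1 := ⟨k - 1, by omega⟩
  rw [arityBound]
  refine le_add_left (Nat.mul_le_mul_left _ ?_)
  have := Nat.pow_le_pow_right hc (Nat.succ_le_succ (arityBound_mono c (Nat.le_of_lt_succ hjk)))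
  simp only [Nat.succ_eq_add_one] at this
  omega

open Classical in
/-- The points of sufficiently large dimension with at most `3 ^ k` entries other than `a`. -/
noncomputable def lowWeight (a : A) (k : ℕ) : Σ n : ℕ, Set (Fin (n + 1) → A) :=
  ⟨arityBound (Nat.card A) k, {x | (Finset.univ.filter fun l => x l ≠ a).card ≤ 3 ^ k}⟩

open Classical in
theorem mk_intStr_of_affine [Finite A] {D : Set (POp A)} (hD : IsTotalClone D)
    (hDρ : D ⊆ Pol {x : Fin 4 → A | x 0 + x 1 = x 2 + x 3}) {n : ℕ} {a : A}
    (ha : const n a ∉ D) : Cardinal.mk (intStr D) = Cardinal.continuum := by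
  have := Fintype.ofFinite A
  have hcpos : 0 < Nat.card A := Nat.card_pos_iff.2 ⟨⟨a⟩, inferInstance⟩
  have hne : ∀ {m : ℕ} {F : (Fin (m + 1) → A) → A}, ofFun F ∈ D → ∃ x, F x ≠ a := by
    intro m F hF
    by_contra! hall
    exact hD.ofFun_const_notMem ha m (funext hall ▸ hF)
  have hne1 : ∀ {m : ℕ} {F : (Fin (m + 1) → A) → A}, ofFun F ∈ D →
      ∃ y, (Finset.univ.filter fun l => y l ≠ a).card ≤ 1 ∧ F y ≠ a := by
    intro m F hF
    obtain ⟨x, hx⟩ := hne hF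
    exact (isAffineFun_of_mem_Pol (hDρ hF)).exists_weight_le_one hx
  have hone : ∀ k : ℕ, 1 ≤ 3 ^ k := fun k => Nat.one_le_pow _ _ (by norm_num)
  have hcard (m : ℕ) [Fintype (Fin m → A)] :
      (Finset.univ : Finset (Fin m → A)).card = Nat.card A ^ m := by
    rw [Finset.card_univ, ← Nat.card_eq_fintype_card, Nat.card_fun, Nat.card_fin]
  refine mk_intStr_eq_continuum
    (fun S => restrictions D ∪ domIdeal D Set.univ (lowWeight a '' S))
    (fun S => union_domIdeal_mem_intStr hD ⟨fun _ _ => Set.mem_univ _, fun _ _ _ _ => Set.mem_univ _⟩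
      (fun _ _ _ _ _ => Set.mem_univ _) (Set.subset_univ _) ?_)
    (fun k => ⟨(lowWeight a k).1, fun x => ⟨x ∈ (lowWeight a k).2, fun _ => a⟩⟩)
    fun S k => ⟨?_, fun hk => ?_⟩
  · rintro _ ⟨k, -, rfl⟩ m t ht
    by_contra! hall
    -- On the diagonal there are only `|A|` points, and each `t i` still differs from `a` somewhere
    -- there.
    have hle := le_mul_card_of_weight_le (S := Finset.univ)
      (t := fun i (x : Fin 1 → A) => t i fun _ => x 0) (a := a) (r := 3 ^ k)
      (fun i => by
        obtain ⟨x, hx⟩ := hne (hD.ofFun_comp (ht i) fun _ => hD.ofFun_proj (n := 0) 0)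
        exact ⟨x, Finset.mem_univ _, hx⟩)
      fun x _ => hall _
    have hb := mul_le_arityBound (Nat.card A) k
    rw [hcard, pow_one] at hle
    simp only [lowWeight] at hle
    rw [mul_add] at hb
    omega
  · rintro (⟨F, hF, hFa⟩ | ⟨-, _, ⟨j, hj, rfl⟩, t, ht, hE⟩)
    · obtain ⟨y, hy, hFy⟩ := hne1 hF
      exact (hFy (hFa y a ⟨hy.trans (hone k), rfl⟩).symm).elim
    · by_contra hk
      have hjk : j ≠ k := fun h => hk (h ▸ hj)
      rcases lt_or_gt_of_ne hjk with hlt | hgt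
      -- Base 3 gives `2 * 3 ^ j + 1 ≤ 3 ^ k`, so the domain of `q k` contains all the points
      -- needed, and the dimension would be at most `3 * 3 ^ j`.
      · have hle := le_of_affine_of_weight_le (r := 3 ^ j) (a := a)
          (fun i => isAffineFun_of_mem_Pol (hDρ (ht i))) (fun i => hne (ht i))
          fun x hx => hE x (hx.trans (by
            have h1 : 3 ^ (j + 1) ≤ 3 ^ k := Nat.pow_le_pow_right (by norm_num) hlt
            have := hone j
            rw [pow_succ] at h1
            omega))
        have hb := mul_le_arityBound (Nat.card A) j
        simp only [lowWeight] at hle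
        rw [mul_add] at hb
        omega
      -- Now the target dimension exceeds `3 ^ j` times the number of all points of the source
      -- power, while points of weight at most one already separate every `t i` from `a`.
      · have hle := le_mul_card_of_weight_le
          (S := Finset.univ.filter fun x => x ∈ (lowWeight a k).2) (t := t) (a := a) (r := 3 ^ j)
          (fun i => by
            obtain ⟨y, hy, hFy⟩ := hne1 (ht i)
            exact ⟨y, Finset.mem_filter.2 ⟨Finset.mem_univ _, hy.trans (hone k)⟩, hFy⟩)
          fun x hx => hE x (Finset.mem_filter.1 hx).2
        have hle' := Nat.mul_le_mul_left (3 ^ j)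
          (Finset.card_filter_le Finset.univ fun x => x ∈ (lowWeight a k).2)
        have hb := mul_pow_le_arityBound hcpos hgt
        rw [hcard] at hle'
        simp only [lowWeight] at hle hle'
        omega
  · exact Or.inr ⟨trivial, _, ⟨k, hk, rfl⟩, fun i x => x i, fun i => hD.ofFun_proj i,
      fun x hx => hx⟩

end

end PartialClones

theorem mainTheorem9 {A : Type*} [Finite A] (D : Set (PartialClones.POp A))
    (hD : PartialClones.IsTotalClone D)
    (hρ : (∃ h : ℕ, 3 ≤ h ∧ h ≤ Nat.card A - 1 ∧ ∃ ρ : Set (Fin h → A),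
            PartialClones.IsUniversalRel ρ ∧ D ⊆ PartialClones.Pol ρ) ∨
          (∃ ρ : Set (Fin 4 → A), PartialClones.IsPrimeAffineRel ρ ∧ D ⊆ PartialClones.Pol ρ))
    (n : ℕ) (a : A) (ha : PartialClones.const n a ∉ D) :
    Cardinal.mk (PartialClones.intStr D) = Cardinal.continuum := by
  rcases hρ with ⟨h, h3, -, ρ, hρ, hDρ⟩ | ⟨ρ, ⟨-, p, _, -, -, rfl⟩, hDρ⟩
  · exact PartialClones.mk_intStr_of_universal hD h3 hρ hDρ ha
  · exact PartialClones.mk_intStr_of_affine hD hDρ ha
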